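/- Let $\mathbb{D}=\{z\in\mathbb{C}:|z|<1\}$. A horodisk is an open Euclidean disk of the form $\{z:|z-(1-r)\zeta|<r\}$ with $|\zeta|=1$ and $0<r<1$. A proper subdomain $G\subsetneq\mathbb{D}$ (nonempty, open and connected) is called horo-convex if for every $\omega\in\mathbb{D}\cap\partial G$ there is a horodisk $H$ with $\omega\in\partial H$ and $G\cap H=\emptyset$. A horo-crescent is a set of the form $\mathbb{D}\setminus\overline{H}$ with $H$ a horodisk. For $w\in G$ let $$d_G(w)=\inf_{\omega\in\mathbb{D}\cap\partial G}\operatorname{arctanh}\left|\frac{w-\omega}{1-\bar{w}\,\omega}\right|$$ be the hyperbolic distance from $w$ to the boundary of $G$, and for $t>0$ let $h(t)=\frac{e^{2t}}{\pi}\sin\frac{\pi}{e^{2t}}$. Let $G\subsetneq\mathbb{D}$ be horo-convex and let $f:\mathbb{D}\to\mathbb{D}$ be holomorphic with $f(\mathbb{D})\subset G$. Then for every $z\in\mathbb{D}$ $$(1-|z|^2)\,\frac{|f'(z)|}{1-|f(z)|^2}\le h\bigl(d_G(f(z))\bigr).$$ Moreover, for each $z\in\mathbb{D}$, equality holds at $z$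 if and only if $G$ is a horo-crescent and $f$ maps $\mathbb{D}$ conformally (that is, holomorphically and bijectively) onto $G$. -/

import Mathlib

namespace Horo

/-- The open unit disk of the complex plane. -/
def unitDisk : Set ℂ := Metric.ball 0 1

/-- Pseudo-hyperbolic distance `|(z - w) / (1 - conj z * w)|` on the unit disk. -/
noncomputable def pseudoHypDist (z w : ℂ) : ℝ :=
  ‖(z - w) / (1 - (starRingEnd ℂ) z * w)‖

/-- Hyperbolic distance on the unit disk, for the metric `|dz| / (1 - |z|^2)`. -/
noncomputable def hypDist (z w : ℂ) : ℝ :=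
  Real.artanh (pseudoHypDist z w)

/-- Hyperbolic distance from `z` to the boundary of `G`. Only boundary points inside the unit disk
are used, the points of the unit circle being at infinite hyperbolic distance. For a nonempty
proper subset `G` of the disk that is open, this is an infimum over a nonempty set. -/
noncomputable def hypDistBoundary (G : Set ℂ) (z : ℂ) : ℝ :=
  sInf (hypDist z '' (unitDisk ∩ frontier G))

/-- Open horodisk: the inside of a circle in the closed unit disk that touches the unit circle
(at `ζ`) from inside and is different from it. -/
def IsHorodisk (H : Set ℂ) : Prop :=
  ∃ (ζ : ℂ) (r : ℝ), ‖ζ‖ = 1 ∧ 0 < r ∧ r < 1 ∧ H = Metric.ball ((1 - (r : ℂ)) * ζ) r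

/-- A proper subdomain `G` of the unit disk is horocyclically convex if each of its boundary points
in the disk lies on the boundary of a horodisk that does not meet `G`. -/
structure IsHoroConvex (G : Set ℂ) : Prop where
  isOpen : IsOpen G
  isConnected : IsConnected G
  ssubset : G ⊂ unitDisk
  exists_horodisk : ∀ ω ∈ unitDisk ∩ frontier G, ∃ H, IsHorodisk H ∧ ω ∈ frontier H ∧ G ∩ H = ∅

/-- Horo-crescent: the exterior in the unit disk of a closed horodisk. -/
def IsHoroCrescent (G : Set ℂ) : Prop :=
  ∃ H, IsHorodisk H ∧ G = unitDisk \ closure H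

/-- `f` maps the unit disk conformally (holomorphically and one-to-one) onto `G`. -/
def IsConformalOnto (f : ℂ → ℂ) (G : Set ℂ) : Prop :=
  DifferentiableOn ℂ f unitDisk ∧ Set.BijOn f unitDisk G

/-- `h(t) = (e^{2t} / π) sin (π / e^{2t})`. -/
noncomputable def h (t : ℝ) : ℝ :=
  Real.exp (2 * t) / Real.pi * Real.sin (Real.pi / Real.exp (2 * t))

end Horo

/-!
In half-plane coordinates `u = (ζ + z) / (ζ - z)` the horodisk at `ζ` of radius `r` is
`c < Re u` with `c = (1 - r) / r`, so the horo-crescent outside it is the strip `0 < Re u < c`.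
The exponential followed by a Cayley transform is a conformal map of the strip onto the unit disk,
and the Schwarz lemma for the composition `F` of these maps with `f` and a disk automorphism says
that a map `f` into the crescent satisfies
`(1 - ‖z‖ ^ 2) * ‖f' z‖ / (1 - ‖f z‖ ^ 2) ≤ sin s / s` with `s = π * Re (u (f z)) / c`, where
equality holds exactly when `f` is a bijection onto the crescent
(`hyperbolic_deriv_le_of_mapsTo_crescent`). That bijectivity of `F` forces `‖F' 0‖ = 1` uses that
the inverse of an injective holomorphic function is holomorphic (`differentiableOn_invFunOn`).

For a horo-convex `G` the hyperbolic distance `d` of `f z` to the boundary is attained at some `ω`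
inside the disk (`IsHoroConvex.exists_hypDistBoundary_eq`), and `G` lies in the crescent cut off by
a horodisk through `ω`. A point at abscissa `x` is at distance at least `log (c / x) / 2` from the
line `Re u = c`, so `s ≥ π * exp (-2 * d)`, and `sin s / s ≤ h d` because `t ↦ sin t / t` decreases
on `(0, π]` (`sin_div_le_h_hypDist`). If equality holds throughout, `f` maps onto the whole
crescent, which therefore is `G`. Conversely, if `G` is a crescent then the distance to its boundary
is attained at the same height in the half-plane, and `h d = sin s / s`
(`h_hypDistBoundary_crescent`).
-/

open Set Metric Filter Topology Complex ComplexConjugate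

namespace Horo

/-! ### Inverses of injective holomorphic functions and the Schwarz lemma -/

/-- Only the isolation of the critical points is proved here, as this is all that the holomorphy of
the inverse needs; injectivity excludes a locally vanishing derivative. -/
theorem eventually_deriv_ne_zero_of_injOn {U : Set ℂ} {F : ℂ → ℂ} (hU : IsOpen U)
    (hF : DifferentiableOn ℂ F U) (hinj : InjOn F U) {a : ℂ} (ha : a ∈ U) :
    ∀ᶠ z in 𝓝[≠] a, deriv F z ≠ 0 := by
  have hd : AnalyticAt ℂ (deriv F) a := (hF.analyticOnNhd hU a ha).deriv
  refine hd.eventually_eq_zero_or_eventually_ne_zero.resolve_left fun h0 ↦ ?_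
  obtain ⟨ε, hε, hball⟩ := Metric.eventually_nhds_iff_ball.1 (h0.and (hU.mem_nhds ha))
  obtain ⟨b, hb, hba⟩ : ∃ b ∈ ball a ε, b ≠ a := by
    exact Filter.nonempty_of_mem (inter_mem (mem_nhdsWithin_of_mem_nhds (ball_mem_nhds a hε))
      (self_mem_nhdsWithin (s := {a}ᶜ)))
  refine hba (hinj (hball b hb).2 ha ?_)
  refine isOpen_ball.is_const_of_deriv_eq_zero (convex_ball a ε).isPreconnected
    (hF.mono fun z hz ↦ (hball z hz).2) (fun z hz ↦ (hball z hz).1) hb (mem_ball_self hε)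

/-- The inverse of an injective holomorphic function is holomorphic: it is continuous by the open
mapping theorem and differentiable off the isolated critical values, which are therefore
removable. -/
theorem differentiableOn_invFunOn {U : Set ℂ} {F : ℂ → ℂ} (hU : IsOpen U)
    (hUc : IsPreconnected U) (hF : DifferentiableOn ℂ F U) (hinj : InjOn F U) :
    DifferentiableOn ℂ (Function.invFunOn F U) (F '' U) := by
  set G := Function.invFunOn F U with hG
  have hGF : ∀ z ∈ U, G (F z) = z := fun z hz ↦ hinj.leftInvOn_invFunOn hz
  rintro _ ⟨a, ha, rfl⟩
  have hopen : ∀ s ⊆ U, IsOpen s → IsOpen (F '' s) := by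
    refine ((hF.analyticOnNhd hU).is_constant_or_isOpen hUc).resolve_left ?_
    rintro ⟨w, hw⟩
    obtain ⟨b, hb, hba⟩ := Filter.nonempty_of_mem (inter_mem
      (mem_nhdsWithin_of_mem_nhds (hU.mem_nhds ha)) (self_mem_nhdsWithin (s := {a}ᶜ)))
    exact hba (hinj hb ha ((hw b hb).trans (hw a ha).symm))
  have hcont : ∀ z ∈ U, Tendsto G (𝓝 (F z)) (𝓝 z) := by
    intro z hz
    refine tendsto_def.2 fun V hV ↦ ?_
    have hVU : V ∩ U ∈ 𝓝 z := inter_mem hV (hU.mem_nhds hz)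
    refine mem_of_superset ((hopen (interior (V ∩ U)) (interior_subset.trans inter_subset_right)
      isOpen_interior).mem_nhds ⟨z, mem_interior_iff_mem_nhds.2 hVU, rfl⟩) ?_
    rintro _ ⟨y, hy, rfl⟩
    have hy' := interior_subset hy
    simpa [hGF y hy'.2] using hy'.1
  have hFU : F '' U ∈ 𝓝 (F a) := (hopen U Subset.rfl hU).mem_nhds ⟨a, ha, rfl⟩
  have hGne : Tendsto G (𝓝[≠] (F a)) (𝓝[≠] a) := by
    refine tendsto_nhdsWithin_iff.2 ⟨(hcont a ha).mono_left nhdsWithin_le_nhds, ?_⟩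
    filter_upwards [self_mem_nhdsWithin, mem_nhdsWithin_of_mem_nhds hFU] with w hw hwU
    rintro (h : G w = a)
    obtain ⟨y, hy, rfl⟩ := hwU
    rw [hGF y hy] at h
    exact hw (by simp [h])
  refine (analyticAt_of_differentiable_on_punctured_nhds_of_continuousAt ?_
    ?_).differentiableAt.differentiableWithinAt
  · filter_upwards [hGne.eventually (eventually_deriv_ne_zero_of_injOn hU hF hinj ha),
      mem_nhdsWithin_of_mem_nhds hFU] with w hw hwU
    obtain ⟨y, hy, rfl⟩ := hwU
    rw [hGF y hy] at hw
    have h1 : HasDerivAt F (deriv F y) (G (F y)) := by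
      rw [hGF y hy]
      exact (hF.differentiableAt (hU.mem_nhds hy)).hasDerivAt
    refine (h1.of_local_left_inverse ?_ hw ?_).differentiableAt
    · simpa [ContinuousAt, hGF y hy] using hcont y hy
    · filter_upwards [(hopen U Subset.rfl hU).mem_nhds ⟨y, hy, rfl⟩]
      rintro _ ⟨x, hx, rfl⟩
      rw [hGF x hx]
  · simpa [ContinuousAt, hGF a ha] using hcont a ha

/-- Schwarz lemma for the derivative at the centre, with its case of equality. -/
theorem norm_deriv_zero_le_one_and_eq_iff_bijOn {F : ℂ → ℂ} (hF : DifferentiableOn ℂ F unitDisk)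
    (hmaps : MapsTo F unitDisk unitDisk) (h0 : F 0 = 0) :
    ‖deriv F 0‖ ≤ 1 ∧ (‖deriv F 0‖ = 1 ↔ BijOn F unitDisk unitDisk) := by
  have hmem : (0 : ℂ) ∈ unitDisk := mem_ball_self one_pos
  have hopen : IsOpen unitDisk := isOpen_ball
  have schwarz : ∀ {g : ℂ → ℂ}, DifferentiableOn ℂ g unitDisk → MapsTo g unitDisk unitDisk →
      g 0 = 0 → ‖deriv g 0‖ ≤ 1 := fun {g} hg hm hg0 ↦
    norm_deriv_le_one_of_mapsTo_ball hg
      (by rw [hg0]; exact fun z hz ↦ ball_subset_closedBall (hm hz)) one_pos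
  refine ⟨schwarz hF hmaps h0, fun heq ↦ ?_, fun hbij ↦ ?_⟩
  · have haff := affine_of_mapsTo_ball_of_norm_dslope_eq_div (R₂ := 1) hF
      (by rw [h0]; exact fun z hz ↦ ball_subset_closedBall (hmaps hz)) hmem (by simpa using heq)
    set C := deriv F 0 with hC
    have haff' : EqOn (fun z ↦ z * C) F unitDisk := fun z hz ↦ by
      simpa [h0] using (haff hz).symm
    have hC0 : C ≠ 0 := by
      rw [← norm_ne_zero_iff, heq]; exact one_ne_zero
    refine BijOn.congr ⟨fun z hz ↦ haff'.mapsTo_iff.2 hmaps hz,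
      fun x _ y _ hxy ↦ mul_right_cancel₀ hC0 hxy, fun w hw ↦ ⟨w / C, ?_, ?_⟩⟩ haff'
    · simpa [unitDisk, heq] using hw
    · simp [hC0]
  · have hΨ := differentiableOn_invFunOn hopen (convex_ball 0 1).isPreconnected hF hbij.injOn
    rw [hbij.image_eq] at hΨ
    -- By the Schwarz lemma for `F` and its inverse, both derivatives have norm at most `1`,
    -- and their product is `1`.
    set Ψ := Function.invFunOn F unitDisk
    have hinv : InvOn Ψ F unitDisk unitDisk := hbij.invOn_invFunOn
    have hΨ0 : Ψ 0 = 0 := by simpa [h0] using hinv.1 hmem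
    have hle := schwarz hΨ (hbij.symm hinv.symm).mapsTo hΨ0
    have h1 : HasDerivAt (Ψ ∘ F) (deriv Ψ 0 * deriv F 0) 0 := by
      refine HasDerivAt.comp 0 ?_ (hF.differentiableAt (hopen.mem_nhds hmem)).hasDerivAt
      rw [h0]
      exact (hΨ.differentiableAt (hopen.mem_nhds hmem)).hasDerivAt
    have h2 : HasDerivAt (Ψ ∘ F) 1 0 := (hasDerivAt_id (0 : ℂ)).congr_of_eventuallyEq
      (by filter_upwards [hopen.mem_nhds hmem] with z hz using hinv.1 hz)
    have h3 : ‖deriv Ψ 0‖ * ‖deriv F 0‖ = 1 := by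
      rw [← norm_mul, h1.unique h2, norm_one]
    have h4 := schwarz hF hmaps h0
    nlinarith [norm_nonneg (deriv F 0), norm_nonneg (deriv Ψ 0)]

/-! ### Automorphisms of the disk -/

theorem mem_unitDisk {z : ℂ} : z ∈ unitDisk ↔ ‖z‖ < 1 := mem_ball_zero_iff

theorem mem_unitDisk_iff_sq {z : ℂ} : z ∈ unitDisk ↔ z.re ^ 2 + z.im ^ 2 < 1 := by
  rw [mem_unitDisk, ← sq_lt_one_iff₀ (norm_nonneg z), Complex.sq_norm, normSq_apply, sq, sq]

theorem one_add_conj_mul_ne_zero {a z : ℂ} (ha : ‖a‖ < 1) (hz : ‖z‖ ≤ 1) :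
    1 + conj a * z ≠ 0 := fun h ↦ by
  have h1 : ‖conj a * z‖ = 1 := by rw [eq_neg_of_add_eq_zero_right h, norm_neg, norm_one]
  rw [norm_mul, RCLike.norm_conj] at h1
  nlinarith [norm_nonneg a, norm_nonneg z]

/-- The automorphism of the unit disk taking `0` to `a`. -/
noncomputable def diskAut (a z : ℂ) : ℂ := (z + a) / (1 + conj a * z)

theorem diskAut_zero (a : ℂ) : diskAut a 0 = a := by simp [diskAut]

theorem hasDerivAt_diskAut {a z : ℂ} (ha : ‖a‖ < 1) (hz : ‖z‖ < 1) :
    HasDerivAt (diskAut a) ((1 - ‖a‖ ^ 2 : ℝ) / (1 + conj a * z) ^ 2) z := by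
  have h := one_add_conj_mul_ne_zero ha hz.le
  refine (((hasDerivAt_id z).add_const a).div
    (((hasDerivAt_id z).const_mul (conj a)).const_add 1) h).congr_deriv ?_
  congr 1
  simp only [id, ofReal_sub, ofReal_one, ofReal_pow, ← conj_mul']
  ring

theorem mapsTo_diskAut {a : ℂ} (ha : a ∈ unitDisk) : MapsTo (diskAut a) unitDisk unitDisk := by
  intro z hz
  have h := one_add_conj_mul_ne_zero (mem_unitDisk.1 ha) (mem_unitDisk.1 hz).le
  rw [mem_unitDisk, diskAut, norm_div, div_lt_one (norm_pos_iff.2 h),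
    ← sq_lt_sq₀ (norm_nonneg _) (norm_nonneg _), Complex.sq_norm, Complex.sq_norm]
  rw [mem_unitDisk_iff_sq] at ha hz
  simp [normSq_apply]
  nlinarith [mul_pos (sub_pos.2 ha) (sub_pos.2 hz)]

theorem diskAut_neg_diskAut {a z : ℂ} (ha : a ∈ unitDisk) (hz : z ∈ unitDisk) :
    diskAut (-a) (diskAut a z) = z := by
  have h := one_add_conj_mul_ne_zero (mem_unitDisk.1 ha) (mem_unitDisk.1 hz).le
  have h2 := one_add_conj_mul_ne_zero (a := -a) (by simpa using mem_unitDisk.1 ha)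
    (mem_unitDisk.1 (mapsTo_diskAut ha hz)).le
  rw [diskAut, div_eq_iff h2, diskAut, map_neg]
  linear_combination div_mul_cancel₀ (z + a) h

theorem bijOn_diskAut {a : ℂ} (ha : a ∈ unitDisk) : BijOn (diskAut a) unitDisk unitDisk := by
  have ha' : -a ∈ unitDisk := by simpa [mem_unitDisk] using ha
  refine InvOn.bijOn (f' := diskAut (-a)) ⟨fun z hz ↦ diskAut_neg_diskAut ha hz, fun z hz ↦ ?_⟩
    (mapsTo_diskAut ha) (mapsTo_diskAut ha')
  simpa using diskAut_neg_diskAut ha' hz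

/-! ### Conformal map of a strip onto the disk -/

/-- The vertical strip `0 < Re u < c`. -/
def strip (c : ℝ) : Set ℂ := {u | 0 < u.re ∧ u.re < c}

theorem sub_conj_ne_zero {q v : ℂ} (hq : 0 < q.im) (hv : 0 < v.im) : v - conj q ≠ 0 := fun h ↦ by
  have := congrArg im h
  simp at this
  linarith

theorem bijOn_cayley {q : ℂ} (hq : 0 < q.im) :
    BijOn (fun v ↦ (v - q) / (v - conj q)) {v | 0 < v.im} unitDisk := by
  have hqq : q - conj q ≠ 0 := sub_conj_ne_zero hq hq
  refine InvOn.bijOn (f' := fun t ↦ (q - conj q * t) / (1 - t)) ⟨fun v hv ↦ ?_, fun t ht ↦ ?_⟩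
    (fun v hv ↦ ?_) (fun t ht ↦ ?_)
  · have h1 := sub_conj_ne_zero hq hv
    have h2 : 1 - (v - q) / (v - conj q) ≠ 0 := by
      rw [one_sub_div h1]
      exact div_ne_zero (by simpa using hqq) h1
    simp only
    rw [div_eq_iff h2]
    field_simp
    ring
  · have h1 : 1 - t ≠ 0 := fun h ↦ by
      rw [mem_unitDisk, ← sub_eq_zero.1 h] at ht; simp at ht
    have h2 : (q - conj q * t) / (1 - t) - conj q ≠ 0 := by
      rw [div_sub' h1]
      refine div_ne_zero ?_ h1
      convert hqq using 1
      ring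
    simp only
    rw [div_eq_iff h2]
    field_simp
    ring
  · have h1 := sub_conj_ne_zero hq hv
    rw [mem_unitDisk, norm_div, div_lt_one (norm_pos_iff.2 h1),
      ← sq_lt_sq₀ (norm_nonneg _) (norm_nonneg _), Complex.sq_norm, Complex.sq_norm]
    simp only [mem_ofPred_eq] at hv
    simp [normSq_apply]
    nlinarith
  · have h1 : 1 - t ≠ 0 := fun h ↦ by
      rw [mem_unitDisk, ← sub_eq_zero.1 h] at ht; simp at ht
    rw [mem_unitDisk_iff_sq] at ht
    have h2 : ((q - conj q * t) / (1 - t)).im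
        = q.im * (1 - (t.re ^ 2 + t.im ^ 2)) / normSq (1 - t) := by
      rw [div_im, ← sub_div, normSq_apply]
      congr 1
      simp
      ring
    simp only [mem_ofPred_eq, h2]
    exact div_pos (mul_pos hq (by linarith)) (normSq_pos.2 h1)

/-- The exponential taking the strip `0 < Re u < c` onto the upper half-plane. -/
noncomputable def stripExp (c : ℝ) (u : ℂ) : ℂ := exp ((Real.pi / c : ℝ) * u * I)

theorem bijOn_stripExp {c : ℝ} (hc : 0 < c) : BijOn (stripExp c) (strip c) {v | 0 < v.im} := by
  have hcπ : (0 : ℝ) < Real.pi / c := div_pos Real.pi_pos hc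
  have him : ∀ u : ℂ, ((Real.pi / c : ℝ) * u * I).im = Real.pi / c * u.re := fun u ↦ by
    rw [mul_I_im, re_ofReal_mul]
  have hlt : ∀ u ∈ strip c, 0 < Real.pi / c * u.re ∧ Real.pi / c * u.re < Real.pi := by
    rintro u ⟨h0, h1⟩
    refine ⟨mul_pos hcπ h0, ?_⟩
    rw [div_mul_eq_mul_div, div_lt_iff₀ hc]
    exact mul_lt_mul_of_pos_left h1 Real.pi_pos
  refine ⟨fun u hu ↦ ?_, fun u hu v hv huv ↦ ?_, fun v hv ↦ ?_⟩
  · simp only [mem_ofPred_eq, stripExp, exp_im, him]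
    exact mul_pos (Real.exp_pos _) (Real.sin_pos_of_pos_of_lt_pi (hlt u hu).1 (hlt u hu).2)
  · have hu' := hlt u hu
    have hv' := hlt v hv
    have := exp_inj_of_neg_pi_lt_of_le_pi (by rw [him]; linarith [Real.pi_pos])
      (by rw [him]; exact hu'.2.le) (by rw [him]; linarith [Real.pi_pos])
      (by rw [him]; exact hv'.2.le) huv
    exact mul_left_cancel₀ (ofReal_ne_zero.2 hcπ.ne') (mul_right_cancel₀ I_ne_zero this)
  · have hv0 : v ≠ 0 := by rintro rfl; simp at hv
    have key : ((Real.pi / c : ℝ) : ℂ) * ((c / Real.pi : ℝ) * (-I * log v)) * I = log v := by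
      rw [← mul_assoc, ← ofReal_mul, div_mul_div_cancel₀ hc.ne', div_self Real.pi_ne_zero]
      simp only [ofReal_one]
      linear_combination -log v * I_mul_I
    refine ⟨(c / Real.pi : ℝ) * (-I * log v), ?_, ?_⟩
    · have hre : (((c / Real.pi : ℝ) : ℂ) * (-I * log v)).re = c / Real.pi * v.arg := by
        rw [re_ofReal_mul]; simp [log_im]
      have harg : 0 < v.arg ∧ v.arg < Real.pi := by
        have h0 := arg_nonneg_iff.2 (le_of_lt hv)
        refine ⟨h0.lt_of_ne' fun h ↦ ?_, (arg_le_pi v).lt_of_ne fun h ↦ ?_⟩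
        · exact hv.ne' (arg_eq_zero_iff.1 h).2
        · exact hv.ne' (arg_eq_pi_iff.1 h).2
      rw [strip, mem_ofPred_eq, hre]
      refine ⟨mul_pos (div_pos hc Real.pi_pos) harg.1, ?_⟩
      rw [div_mul_eq_mul_div, div_lt_iff₀ Real.pi_pos]
      exact mul_lt_mul_of_pos_left harg.2 hc
    · rw [stripExp, key, exp_log hv0]

/-- The conformal map of the strip `0 < Re u < c` onto the unit disk taking `p` to `0`. -/
noncomputable def stripToDisk (c : ℝ) (p u : ℂ) : ℂ :=
  (stripExp c u - stripExp c p) / (stripExp c u - conj (stripExp c p))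

theorem stripToDisk_self (c : ℝ) (p : ℂ) : stripToDisk c p p = 0 := by simp [stripToDisk]

theorem bijOn_stripToDisk {c : ℝ} (hc : 0 < c) {p : ℂ} (hp : p ∈ strip c) :
    BijOn (stripToDisk c p) (strip c) unitDisk :=
  (bijOn_cayley ((bijOn_stripExp hc).mapsTo hp)).comp (bijOn_stripExp hc)

theorem differentiableAt_stripToDisk {c : ℝ} (hc : 0 < c) {p u : ℂ} (hp : p ∈ strip c)
    (hu : u ∈ strip c) : DifferentiableAt ℂ (stripToDisk c p) u := by
  have h := sub_conj_ne_zero ((bijOn_stripExp hc).mapsTo hp) ((bijOn_stripExp hc).mapsTo hu)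
  unfold stripToDisk
  refine DifferentiableAt.div ?_ ?_ h <;> unfold stripExp <;> fun_prop

theorem norm_deriv_stripToDisk_self {c : ℝ} (hc : 0 < c) {p : ℂ} (hp : p ∈ strip c) :
    ‖deriv (stripToDisk c p) p‖ = Real.pi / c / (2 * Real.sin (Real.pi / c * p.re)) := by
  have him := (bijOn_stripExp hc).mapsTo hp
  have h := sub_conj_ne_zero him him
  have he : HasDerivAt (stripExp c) (stripExp c p * ((Real.pi / c : ℝ) * I)) p := by
    refine (((hasDerivAt_id p).const_mul ((Real.pi / c : ℝ) : ℂ)).mul_const I).cexp.congr_deriv ?_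
    simp [stripExp]
  have hd := (he.sub_const (stripExp c p)).div (he.sub_const (conj (stripExp c p))) h
  have hsub : stripExp c p - conj (stripExp c p) = (2 * (stripExp c p).im : ℝ) * I :=
    sub_conj _
  have himeq : (stripExp c p).im = ‖stripExp c p‖ * Real.sin (Real.pi / c * p.re) := by
    rw [stripExp, exp_im, norm_exp, mul_I_im, re_ofReal_mul]
  have hn : 0 < ‖stripExp c p‖ := norm_pos_iff.2 (exp_ne_zero _)
  have hpos : 0 < (stripExp c p).im := him
  have hs : 0 < Real.sin (Real.pi / c * p.re) := by
    rw [himeq] at hpos; exact pos_of_mul_pos_right hpos hn.le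
  have hd' : HasDerivAt (stripToDisk c p) (stripExp c p * ((Real.pi / c : ℝ) * I) /
      (stripExp c p - conj (stripExp c p))) p := by
    refine hd.congr_deriv ?_
    rw [sub_self, zero_mul, sub_zero, sq, mul_div_mul_right _ _ h]
  rw [hd'.deriv, hsub, himeq]
  simp only [norm_div, norm_mul, norm_I, mul_one, norm_real, Real.norm_eq_abs, abs_two,
    abs_norm, abs_of_pos hs, abs_of_pos hc, abs_of_pos Real.pi_pos]
  field_simp

/-! ### Half-plane coordinates at a point of the unit circle -/

/-- The Cayley transform of the unit disk onto the right half-plane taking `ζ` to infinity; it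
takes the horocycles at `ζ` to the vertical lines. -/
noncomputable def toHalfPlane (ζ z : ℂ) : ℂ := (ζ + z) / (ζ - z)

theorem sub_ne_zero_of_norm_lt_one {ζ z : ℂ} (hζ : ‖ζ‖ = 1) (hz : ‖z‖ < 1) : ζ - z ≠ 0 :=
  fun h ↦ by rw [← sub_eq_zero.1 h, hζ] at hz; exact hz.false

theorem re_toHalfPlane {ζ : ℂ} (hζ : ‖ζ‖ = 1) (z : ℂ) :
    (toHalfPlane ζ z).re = (1 - ‖z‖ ^ 2) / ‖ζ - z‖ ^ 2 := by
  have h1 : ζ.re * ζ.re + ζ.im * ζ.im = 1 := by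
    rw [← normSq_apply, ← Complex.sq_norm, hζ, one_pow]
  rw [toHalfPlane, div_re, ← add_div, Complex.sq_norm, Complex.sq_norm, normSq_apply z]
  congr 1
  simp
  linear_combination h1

theorem hasDerivAt_toHalfPlane {ζ z : ℂ} (hζ : ‖ζ‖ = 1) (hz : ‖z‖ < 1) :
    HasDerivAt (toHalfPlane ζ) (2 * ζ / (ζ - z) ^ 2) z := by
  have h := sub_ne_zero_of_norm_lt_one hζ hz
  refine (((hasDerivAt_id z).const_add ζ).div ((hasDerivAt_id z).const_sub ζ) h).congr_deriv ?_
  congr 1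
  simp only [id]
  ring

theorem norm_deriv_toHalfPlane {ζ z : ℂ} (hζ : ‖ζ‖ = 1) (hz : ‖z‖ < 1) :
    ‖deriv (toHalfPlane ζ) z‖ = 2 * (toHalfPlane ζ z).re / (1 - ‖z‖ ^ 2) := by
  have h : (0 : ℝ) < 1 - ‖z‖ ^ 2 := by nlinarith [norm_nonneg z]
  rw [(hasDerivAt_toHalfPlane hζ hz).deriv, re_toHalfPlane hζ, norm_div, norm_mul, hζ, norm_pow]
  simp only [Complex.norm_ofNat, mul_one]
  field_simp

theorem bijOn_toHalfPlane {ζ : ℂ} (hζ : ‖ζ‖ = 1) :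
    BijOn (toHalfPlane ζ) unitDisk {u | 0 < u.re} := by
  have hζ0 : ζ ≠ 0 := norm_ne_zero_iff.1 (by rw [hζ]; exact one_ne_zero)
  have hu1 : ∀ u : ℂ, 0 < u.re → u + 1 ≠ 0 := fun u hu h ↦ by
    have := congrArg re h
    simp at this
    linarith
  have hmaps : MapsTo (toHalfPlane ζ) unitDisk {u | 0 < u.re} := fun z hz ↦ by
    rw [mem_unitDisk] at hz
    rw [mem_ofPred_eq, re_toHalfPlane hζ]
    have := norm_pos_iff.2 (sub_ne_zero_of_norm_lt_one hζ hz)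
    exact div_pos (by nlinarith [norm_nonneg z]) (by positivity)
  refine InvOn.bijOn (f' := fun u ↦ ζ * (u - 1) / (u + 1)) ⟨fun z hz ↦ ?_, fun u hu ↦ ?_⟩
    hmaps (fun u hu ↦ ?_)
  · have h := sub_ne_zero_of_norm_lt_one hζ (mem_unitDisk.1 hz)
    simp only
    rw [div_eq_iff (hu1 _ (hmaps hz)), toHalfPlane]
    field_simp
    ring
  · have h := hu1 u hu
    have h2 : ζ - ζ * (u - 1) / (u + 1) = 2 * ζ / (u + 1) := by
      field_simp
      ring
    rw [toHalfPlane, h2, div_eq_iff (div_ne_zero (mul_ne_zero two_ne_zero hζ0) h)]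
    field_simp
    ring
  · have h := hu1 u hu
    rw [mem_ofPred_eq] at hu
    rw [mem_unitDisk, norm_div, norm_mul, hζ, one_mul, div_lt_one (norm_pos_iff.2 h),
      ← sq_lt_sq₀ (norm_nonneg _) (norm_nonneg _), Complex.sq_norm, Complex.sq_norm]
    simp [normSq_apply]
    nlinarith

/-- The side of a point of the unit disk with respect to a horocycle, read off in the half-plane;
the horocycle of radius `r` becomes the line `Re u = (1 - r) / r`. -/
theorem norm_sub_sq_sub_sq {ζ z : ℂ} {r : ℝ} (hζ : ‖ζ‖ = 1) (hr : 0 < r) (hz : ‖z‖ < 1) :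
    ‖z - (1 - (r : ℂ)) * ζ‖ ^ 2 - r ^ 2
      = r * ‖ζ - z‖ ^ 2 * ((1 - r) / r - (toHalfPlane ζ z).re) := by
  have h1 : ζ.re * ζ.re + ζ.im * ζ.im = 1 := by
    rw [← normSq_apply, ← Complex.sq_norm, hζ, one_pow]
  have h := norm_ne_zero_iff.2 (sub_ne_zero_of_norm_lt_one hζ hz)
  have h2 : r * ‖ζ - z‖ ^ 2 * ((1 - r) / r - (1 - ‖z‖ ^ 2) / ‖ζ - z‖ ^ 2)
      = (1 - r) * ‖ζ - z‖ ^ 2 - r * (1 - ‖z‖ ^ 2) := by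
    field_simp
  rw [re_toHalfPlane hζ, h2]
  simp only [Complex.sq_norm, normSq_apply]
  simp
  linear_combination (1 - r) * (-r) * h1

theorem mem_closedBall_iff_le_re {ζ z : ℂ} {r : ℝ} (hζ : ‖ζ‖ = 1) (hr : 0 < r) (hz : ‖z‖ < 1) :
    z ∈ closedBall ((1 - (r : ℂ)) * ζ) r ↔ (1 - r) / r ≤ (toHalfPlane ζ z).re := by
  have h := norm_pos_iff.2 (sub_ne_zero_of_norm_lt_one hζ hz)
  have hpos : 0 < r * ‖ζ - z‖ ^ 2 := by positivity
  rw [mem_closedBall, dist_eq_norm_sub, ← sq_le_sq₀ (norm_nonneg _) hr.le, ← sub_nonpos,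
    norm_sub_sq_sub_sq hζ hr hz, ← sub_nonpos (b := (toHalfPlane ζ z).re)]
  constructor <;> intro h' <;> nlinarith

theorem mem_sphere_iff_re_eq {ζ z : ℂ} {r : ℝ} (hζ : ‖ζ‖ = 1) (hr : 0 < r) (hz : ‖z‖ < 1) :
    z ∈ sphere ((1 - (r : ℂ)) * ζ) r ↔ (toHalfPlane ζ z).re = (1 - r) / r := by
  have h := norm_pos_iff.2 (sub_ne_zero_of_norm_lt_one hζ hz)
  have hpos : 0 < r * ‖ζ - z‖ ^ 2 := by positivity
  rw [mem_sphere, dist_eq_norm_sub, ← sq_eq_sq₀ (norm_nonneg _) hr.le, ← sub_eq_zero,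
    norm_sub_sq_sub_sq hζ hr hz, mul_eq_zero, or_iff_right hpos.ne', sub_eq_zero, eq_comm]

/-- The horo-crescent at `ζ` is conformally the strip between the imaginary axis and the line
which is the image of the horocycle. -/
theorem bijOn_toHalfPlane_crescent {ζ : ℂ} {r : ℝ} (hζ : ‖ζ‖ = 1) (hr : 0 < r) :
    BijOn (toHalfPlane ζ) (unitDisk \ closedBall ((1 - (r : ℂ)) * ζ) r)
      (strip ((1 - r) / r)) := by
  have hb := bijOn_toHalfPlane hζ
  refine ⟨fun z hz ↦ ⟨hb.mapsTo hz.1, ?_⟩, hb.injOn.mono sdiff_subset, fun u hu ↦ ?_⟩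
  · exact not_le.1 fun h ↦ hz.2 ((mem_closedBall_iff_le_re hζ hr (mem_unitDisk.1 hz.1)).2 h)
  · obtain ⟨z, hz, rfl⟩ := hb.surjOn hu.1
    exact ⟨z, ⟨hz, fun h ↦ hu.2.not_ge
      ((mem_closedBall_iff_le_re hζ hr (mem_unitDisk.1 hz)).1 h)⟩, rfl⟩

/-! ### Schwarz–Pick inequality for horo-crescents -/

theorem bijOn_left_comp_right_iff {s t : Set ℂ} {m e f : ℂ → ℂ} (hm : BijOn m unitDisk unitDisk)
    (he : BijOn e s t) (hf : MapsTo f unitDisk s) :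
    BijOn (fun z ↦ e (f (m z))) unitDisk t ↔ BijOn f unitDisk s := by
  refine ⟨fun h ↦ ⟨hf, fun x hx y hy hxy ↦ ?_, fun w hw ↦ ?_⟩, fun h ↦ he.comp (h.comp hm)⟩
  · obtain ⟨x', hx', rfl⟩ := hm.surjOn hx
    obtain ⟨y', hy', rfl⟩ := hm.surjOn hy
    rw [h.injOn hx' hy' (congrArg e hxy)]
  · obtain ⟨z, hz, hzw⟩ := h.surjOn (he.mapsTo hw)
    exact ⟨m z, hm.mapsTo hz, he.injOn (hf (hm.mapsTo hz)) hw hzw⟩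

/-- Schwarz–Pick inequality for maps of the unit disk into a horo-crescent, with its case of
equality. The bound `sin s / s` is the ratio of the hyperbolic densities of the disk and of the
crescent at `f a`. -/
theorem hyperbolic_deriv_le_of_mapsTo_crescent {ζ : ℂ} {r : ℝ} (hζ : ‖ζ‖ = 1) (hr : 0 < r)
    (hr1 : r < 1) {f : ℂ → ℂ} (hf : DifferentiableOn ℂ f unitDisk)
    (hmaps : MapsTo f unitDisk (unitDisk \ closedBall ((1 - (r : ℂ)) * ζ) r)) {a : ℂ}
    (ha : a ∈ unitDisk) {s : ℝ}
    (hs : s = Real.pi / ((1 - r) / r) * (toHalfPlane ζ (f a)).re) :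
    (1 - ‖a‖ ^ 2) * (‖deriv f a‖ / (1 - ‖f a‖ ^ 2)) ≤ Real.sin s / s ∧
    ((1 - ‖a‖ ^ 2) * (‖deriv f a‖ / (1 - ‖f a‖ ^ 2)) = Real.sin s / s ↔
      BijOn f unitDisk (unitDisk \ closedBall ((1 - (r : ℂ)) * ζ) r)) := by
  set c := (1 - r) / r with hc
  have hcpos : 0 < c := div_pos (sub_pos.2 hr1) hr
  have hopen : IsOpen unitDisk := isOpen_ball
  have h0 : (0 : ℂ) ∈ unitDisk := mem_ball_self one_pos
  have hu := bijOn_toHalfPlane_crescent hζ hr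
  set p := toHalfPlane ζ (f a) with hp
  have hpS : p ∈ strip c := hu.mapsTo (hmaps ha)
  have hm := bijOn_diskAut ha
  have he := (bijOn_stripToDisk hcpos hpS).comp hu
  have hfa : ∀ z ∈ unitDisk, ‖f z‖ < 1 := fun z hz ↦ mem_unitDisk.1 (hmaps hz).1
  have hmaps' := he.mapsTo.comp (hmaps.comp hm.mapsTo)
  have hderiv : ∀ z ∈ unitDisk, HasDerivAt
      (fun z ↦ stripToDisk c p (toHalfPlane ζ (f (diskAut a z))))
      (deriv (stripToDisk c p) (toHalfPlane ζ (f (diskAut a z))) *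
        (deriv (toHalfPlane ζ) (f (diskAut a z)) *
          (deriv f (diskAut a z) * ((1 - ‖a‖ ^ 2 : ℝ) / (1 + conj a * z) ^ 2)))) z := by
    intro z hz
    have hmz := hm.mapsTo hz
    have h1 := hasDerivAt_diskAut (mem_unitDisk.1 ha) (mem_unitDisk.1 hz)
    have h2 := (hf.differentiableAt (hopen.mem_nhds hmz)).hasDerivAt.comp z h1
    have h3 := (hasDerivAt_toHalfPlane hζ (hfa _ hmz)).differentiableAt.hasDerivAt.comp z h2
    exact (differentiableAt_stripToDisk hcpos hpS
      (hu.mapsTo (hmaps hmz))).hasDerivAt.comp z h3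
  have hΦ := norm_deriv_zero_le_one_and_eq_iff_bijOn
    (F := fun z ↦ stripToDisk c p (toHalfPlane ζ (f (diskAut a z))))
    (fun z hz ↦ (hderiv z hz).differentiableAt.differentiableWithinAt) hmaps'
    (by simp only [diskAut_zero]; exact stripToDisk_self c p)
  -- The norm of the derivative at `0` of the composition is the ratio of the two sides.
  have hbij := bijOn_left_comp_right_iff hm he hmaps
  simp only [Function.comp_apply] at hbij
  rw [hbij] at hΦ
  have hspos : 0 < s := hs ▸ mul_pos (div_pos Real.pi_pos hcpos) hpS.1
  have hslt : s < Real.pi := by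
    rw [hs, div_mul_eq_mul_div, div_lt_iff₀ hcpos]
    exact mul_lt_mul_of_pos_left hpS.2 Real.pi_pos
  have hsin : 0 < Real.sin s := Real.sin_pos_of_pos_of_lt_pi hspos hslt
  have hapos : 0 < 1 - ‖a‖ ^ 2 := by nlinarith [norm_nonneg a, mem_unitDisk.1 ha]
  have hval : ‖deriv (fun z ↦ stripToDisk c p (toHalfPlane ζ (f (diskAut a z)))) 0‖ =
      (1 - ‖a‖ ^ 2) * (‖deriv f a‖ / (1 - ‖f a‖ ^ 2)) / (Real.sin s / s) := by
    rw [(hderiv 0 h0).deriv, diskAut_zero, norm_mul, norm_mul, norm_mul, ← hp,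
      norm_deriv_stripToDisk_self hcpos hpS, norm_deriv_toHalfPlane hζ (hfa a ha), ← hp, ← hs]
    simp only [mul_zero, add_zero, one_pow, div_one, norm_real, Real.norm_eq_abs,
      abs_of_pos hapos]
    generalize 1 - ‖f a‖ ^ 2 = k
    rw [hs]
    rw [hs] at hsin
    field_simp
  rw [hval, div_le_one (div_pos hsin hspos), div_eq_one_iff_eq (div_pos hsin hspos).ne'] at hΦ
  exact hΦ

/-! ### Hyperbolic distance -/

theorem pseudoHypDist_eq_toHalfPlane {ζ w v : ℂ} (hζ : ‖ζ‖ = 1) (hw : ‖w‖ < 1)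
    (hv : ‖v‖ < 1) :
    pseudoHypDist w v = ‖toHalfPlane ζ w - toHalfPlane ζ v‖ /
      ‖conj (toHalfPlane ζ w) + toHalfPlane ζ v‖ := by
  have h1 := sub_ne_zero_of_norm_lt_one hζ hw
  have h2 := sub_ne_zero_of_norm_lt_one hζ hv
  have h3 : conj ζ - conj w ≠ 0 := by
    rw [← map_sub]; exact (map_ne_zero _).2 h1
  have h4 : conj ζ * ζ = 1 := by rw [conj_mul', hζ]; simp
  have e1 : toHalfPlane ζ w - toHalfPlane ζ v = 2 * ζ * (w - v) / ((ζ - w) * (ζ - v)) := by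
    rw [toHalfPlane, toHalfPlane, div_sub_div _ _ h1 h2]
    congr 1
    ring
  have e2 : conj (toHalfPlane ζ w) + toHalfPlane ζ v =
      2 * (1 - conj w * v) / ((conj ζ - conj w) * (ζ - v)) := by
    rw [toHalfPlane, toHalfPlane, map_div₀, map_add, map_sub, div_add_div _ _ h3 h2]
    congr 1
    linear_combination 2 * h4
  have h5 : ‖conj ζ - conj w‖ = ‖ζ - w‖ := by rw [← map_sub, RCLike.norm_conj]
  rw [e1, e2, pseudoHypDist]
  simp only [norm_div, norm_mul, h5, hζ]
  have := norm_ne_zero_iff.2 h1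
  have := norm_ne_zero_iff.2 h2
  rw [div_div_div_cancel_right₀ (by positivity), mul_one, mul_div_mul_left _ _ (by simp)]

theorem exp_two_mul_artanh {p : ℝ} (hp0 : -1 < p) (hp1 : p < 1) :
    Real.exp (2 * Real.artanh p) = (1 + p) / (1 - p) := by
  rw [two_mul, Real.exp_add, Real.exp_artanh ⟨hp0, hp1⟩, Real.mul_self_sqrt]
  exact div_nonneg (by linarith) (by linarith)

theorem pseudoHypDist_nonneg (w v : ℂ) : 0 ≤ pseudoHypDist w v := norm_nonneg _

theorem one_sub_conj_mul_ne_zero {w v : ℂ} (hw : ‖w‖ < 1) (hv : ‖v‖ ≤ 1) :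
    1 - conj w * v ≠ 0 := by
  simpa [sub_eq_add_neg] using one_add_conj_mul_ne_zero (a := w) (z := -v) hw (by simpa using hv)

theorem pseudoHypDist_lt_one {w v : ℂ} (hw : w ∈ unitDisk) (hv : v ∈ unitDisk) :
    pseudoHypDist w v < 1 := by
  have hw' : -w ∈ unitDisk := by simpa [mem_unitDisk] using hw
  have h := mem_unitDisk.1 (mapsTo_diskAut hw' hv)
  have e : pseudoHypDist w v = ‖diskAut (-w) v‖ := by
    rw [pseudoHypDist, diskAut, norm_div, norm_div, norm_sub_rev, map_neg, neg_mul,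
      ← sub_eq_add_neg, ← sub_eq_add_neg]
  rwa [e]

theorem pseudoHypDist_of_norm_eq_one {w v : ℂ} (hw : ‖w‖ < 1) (hv : ‖v‖ = 1) :
    pseudoHypDist w v = 1 := by
  have h : conj v * v = 1 := by rw [conj_mul', hv]; simp
  have e : 1 - conj w * v = conj (v - w) * v := by
    rw [map_sub]
    linear_combination -h
  rw [pseudoHypDist, norm_div, e, norm_mul, RCLike.norm_conj, hv, mul_one, norm_sub_rev, div_self]
  exact norm_ne_zero_iff.2 (sub_ne_zero_of_norm_lt_one hv hw)

theorem hypDist_le_hypDist {w v v' : ℂ} (hw : w ∈ unitDisk) (hv' : v' ∈ unitDisk)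
    (h : pseudoHypDist w v ≤ pseudoHypDist w v') : hypDist w v ≤ hypDist w v' :=
  Real.artanh_le_artanh (by linarith [pseudoHypDist_nonneg w v]) (pseudoHypDist_lt_one hw hv') h

theorem IsHoroConvex.nonempty_inter_frontier {G : Set ℂ} (hG : IsHoroConvex G) :
    (unitDisk ∩ frontier G).Nonempty := by
  by_contra hne
  refine hG.ssubset.2 ((convex_ball (0 : ℂ) 1).isPreconnected.subset_of_closure_inter_subset
    hG.isOpen ?_ ?_)
  · rw [show ball (0 : ℂ) 1 = unitDisk from rfl, inter_eq_right.2 hG.ssubset.1]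
    exact hG.isConnected.nonempty
  · rintro z ⟨hz, hzD⟩
    by_contra hzG
    exact hne ⟨z, hzD, hz, fun h ↦ hzG (interior_subset h)⟩

/-- The pseudo-hyperbolic distance extends continuously by `1` to the unit circle, so the minimum
over the compact set of all boundary points in the closed disk is attained inside the disk. -/
theorem IsHoroConvex.exists_hypDistBoundary_eq {G : Set ℂ} (hG : IsHoroConvex G) {w : ℂ}
    (hw : w ∈ unitDisk) :
    ∃ ω ∈ unitDisk ∩ frontier G, hypDistBoundary G w = hypDist w ω := by
  obtain ⟨ω₀, hω₀, hω₀G⟩ := hG.nonempty_inter_frontier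
  have hcont : ContinuousOn (pseudoHypDist w) (closedBall 0 1 ∩ frontier G) := by
    unfold pseudoHypDist
    refine ContinuousOn.norm (ContinuousOn.div (by fun_prop) (by fun_prop) fun v hv ↦ ?_)
    exact one_sub_conj_mul_ne_zero (mem_unitDisk.1 hw) (mem_closedBall_zero_iff.1 hv.1)
  obtain ⟨ω, ⟨hω, hωG⟩, hmin⟩ := ((isCompact_closedBall (0 : ℂ) 1).inter_right
    isClosed_frontier).exists_isMinOn ⟨ω₀, ball_subset_closedBall hω₀, hω₀G⟩ hcont
  have hωD : ω ∈ unitDisk := by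
    refine mem_unitDisk.2 ((mem_closedBall_zero_iff.1 hω).lt_of_ne fun h ↦ ?_)
    have h1 := isMinOn_iff.1 hmin ω₀ ⟨ball_subset_closedBall hω₀, hω₀G⟩
    rw [pseudoHypDist_of_norm_eq_one (mem_unitDisk.1 hw) h] at h1
    exact h1.not_gt (pseudoHypDist_lt_one hw hω₀)
  refine ⟨ω, ⟨hωD, hωG⟩, IsLeast.csInf_eq ⟨⟨ω, ⟨hωD, hωG⟩, rfl⟩, ?_⟩⟩
  rintro _ ⟨v, ⟨hv, hvG⟩, rfl⟩
  exact hypDist_le_hypDist hw hv (isMinOn_iff.1 hmin v ⟨ball_subset_closedBall hv, hvG⟩)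

/-- In the half-plane, the distance between points on two vertical lines is least when the points
are at the same height. -/
theorem div_le_pseudoHypDist {ζ w v : ℂ} (hζ : ‖ζ‖ = 1) (hw : w ∈ unitDisk) (hv : v ∈ unitDisk)
    (hwv : (toHalfPlane ζ w).re ≤ (toHalfPlane ζ v).re) :
    ((toHalfPlane ζ v).re - (toHalfPlane ζ w).re) / ((toHalfPlane ζ v).re + (toHalfPlane ζ w).re)
      ≤ pseudoHypDist w v := by
  rw [pseudoHypDist_eq_toHalfPlane hζ (mem_unitDisk.1 hw) (mem_unitDisk.1 hv)]
  have h1 : 0 < (toHalfPlane ζ w).re := (bijOn_toHalfPlane hζ).mapsTo hw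
  generalize toHalfPlane ζ w = a at *
  generalize toHalfPlane ζ v = b at *
  have h2 : 0 < ‖conj a + b‖ := norm_pos_iff.2 fun h ↦ by
    have := congrArg re h
    simp at this
    linarith
  rw [div_le_div_iff₀ (by linarith) h2, ← sq_le_sq₀ (mul_nonneg (by linarith) h2.le)
    (mul_nonneg (norm_nonneg _) (by linarith)), mul_pow, mul_pow, Complex.sq_norm, Complex.sq_norm,
    normSq_apply, normSq_apply]
  simp
  nlinarith [mul_nonneg (mul_nonneg h1.le (h1.le.trans hwv)) (sq_nonneg (a.im - b.im))]

theorem pseudoHypDist_eq_div_of_im_eq {ζ w v : ℂ} (hζ : ‖ζ‖ = 1) (hw : w ∈ unitDisk)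
    (hv : v ∈ unitDisk) (hwv : (toHalfPlane ζ w).re ≤ (toHalfPlane ζ v).re)
    (him : (toHalfPlane ζ v).im = (toHalfPlane ζ w).im) :
    pseudoHypDist w v = ((toHalfPlane ζ v).re - (toHalfPlane ζ w).re) /
      ((toHalfPlane ζ v).re + (toHalfPlane ζ w).re) := by
  rw [pseudoHypDist_eq_toHalfPlane hζ (mem_unitDisk.1 hw) (mem_unitDisk.1 hv)]
  have h1 : 0 < (toHalfPlane ζ w).re := (bijOn_toHalfPlane hζ).mapsTo hw
  generalize toHalfPlane ζ w = a at *
  generalize toHalfPlane ζ v = b at *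
  have e1 : a - b = -((b.re - a.re : ℝ) : ℂ) := by apply Complex.ext <;> simp [him]
  have e2 : conj a + b = ((b.re + a.re : ℝ) : ℂ) := by
    apply Complex.ext <;> simp [him, add_comm]
  rw [e1, e2, norm_neg, norm_real, norm_real, Real.norm_of_nonneg (by linarith),
    Real.norm_of_nonneg (by linarith)]

/-! ### Distance to a horocycle and the function `h` -/

theorem sin_div_self_le {s t : ℝ} (ht : 0 < t) (hts : t ≤ s) (hs : s ≤ Real.pi) :
    Real.sin s / s ≤ Real.sin t / t := by
  have hs0 := ht.trans_le hts
  -- Concavity of `sin` on `[0, π]` at the point `t = (t / s) * s + (1 - t / s) * 0`.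
  have h := strictConcaveOn_sin_Icc.concaveOn.2 (show s ∈ Icc 0 Real.pi from ⟨hs0.le, hs⟩)
    (show (0 : ℝ) ∈ Icc 0 Real.pi from ⟨le_rfl, Real.pi_pos.le⟩) (div_nonneg ht.le hs0.le)
    (sub_nonneg.2 ((div_le_one hs0).2 hts)) (add_sub_cancel _ _)
  simp only [smul_eq_mul, Real.sin_zero, mul_zero, add_zero, div_mul_cancel₀ _ hs0.ne'] at h
  rw [div_le_div_iff₀ hs0 ht]
  rw [div_mul_eq_mul_div, div_le_iff₀ hs0] at h
  linarith

theorem h_eq_sin_div (t : ℝ) :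
    h t = Real.sin (Real.pi / Real.exp (2 * t)) / (Real.pi / Real.exp (2 * t)) := by
  rw [h, div_div_eq_mul_div, div_mul_eq_mul_div, mul_comm]

/-- The parameter `π / exp (2 * d)` of `h` at the distance `d` from `w` to `v` is at most `s`, which
would be its value if the two points were at the same height in the half-plane. -/
theorem sin_div_le_h_hypDist {ζ w v : ℂ} (hζ : ‖ζ‖ = 1) (hw : w ∈ unitDisk) (hv : v ∈ unitDisk)
    (hwv : (toHalfPlane ζ w).re ≤ (toHalfPlane ζ v).re) {s : ℝ}
    (hs : s = Real.pi / (toHalfPlane ζ v).re * (toHalfPlane ζ w).re) :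
    Real.sin s / s ≤ h (hypDist w v) := by
  have h1 : 0 < (toHalfPlane ζ w).re := (bijOn_toHalfPlane hζ).mapsTo hw
  have h2 := h1.trans_le hwv
  have hp := div_le_pseudoHypDist hζ hw hv hwv
  have hp0 := pseudoHypDist_nonneg w v
  have hp1 := pseudoHypDist_lt_one hw hv
  rw [h_eq_sin_div, hypDist, exp_two_mul_artanh (by linarith) hp1, hs]
  generalize pseudoHypDist w v = p at *
  generalize (toHalfPlane ζ w).re = x at *
  generalize (toHalfPlane ζ v).re = y at *
  have h3 : y / x ≤ (1 + p) / (1 - p) := by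
    rw [div_le_iff₀ (by linarith)] at hp
    rw [div_le_div_iff₀ h1 (by linarith)]
    linarith
  refine sin_div_self_le (div_pos Real.pi_pos (div_pos (by linarith) (by linarith))) ?_ ?_
  · rw [div_mul]
    exact div_le_div_of_nonneg_left Real.pi_pos.le (div_pos h2 h1) h3
  · rw [div_mul_eq_mul_div, div_le_iff₀ h2]
    exact mul_le_mul_of_nonneg_left hwv Real.pi_pos.le

/-- Equality holds in `sin_div_le_h_hypDist` for points at the same height in the half-plane. -/
theorem h_hypDist_eq_of_im_eq {ζ w v : ℂ} (hζ : ‖ζ‖ = 1) (hw : w ∈ unitDisk) (hv : v ∈ unitDisk)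
    (hwv : (toHalfPlane ζ w).re ≤ (toHalfPlane ζ v).re)
    (him : (toHalfPlane ζ v).im = (toHalfPlane ζ w).im) {s : ℝ}
    (hs : s = Real.pi / (toHalfPlane ζ v).re * (toHalfPlane ζ w).re) :
    h (hypDist w v) = Real.sin s / s := by
  have h1 : 0 < (toHalfPlane ζ w).re := (bijOn_toHalfPlane hζ).mapsTo hw
  have h2 := h1.trans_le hwv
  have hp0 := pseudoHypDist_nonneg w v
  have hp1 := pseudoHypDist_lt_one hw hv
  rw [h_eq_sin_div, hypDist, exp_two_mul_artanh (by linarith) hp1,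
    pseudoHypDist_eq_div_of_im_eq hζ hw hv hwv him, hs]
  generalize (toHalfPlane ζ w).re = x at *
  generalize (toHalfPlane ζ v).re = y at *
  have h3 : Real.pi / ((1 + (y - x) / (y + x)) / (1 - (y - x) / (y + x))) = Real.pi / y * x := by
    rw [one_add_div (by linarith), one_sub_div (by linarith),
      div_div_div_cancel_right₀ (by linarith)]
    ring_nf
    field_simp
  rw [h3]

/-! ### Distance to the boundary of a horo-crescent -/

/-- Inside the unit disk the boundary of a crescent is the horocycle; the arc of the unit circle
plays no role in `hypDistBoundary`. -/
theorem inter_frontier_crescent {c : ℂ} {r : ℝ} (hr : r ≠ 0) :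
    unitDisk ∩ frontier (unitDisk \ closedBall c r) = unitDisk ∩ sphere c r := by
  rw [sdiff_eq, inter_comm unitDisk (closedBall c r)ᶜ, inter_comm,
    frontier_inter_open_inter (t := unitDisk) isOpen_ball, frontier_compl,
    frontier_closedBall c hr, inter_comm]

theorem h_hypDistBoundary_crescent {ζ w : ℂ} {r : ℝ} (hζ : ‖ζ‖ = 1) (hr : 0 < r)
    (hw : w ∈ unitDisk \ closedBall ((1 - (r : ℂ)) * ζ) r) {s : ℝ}
    (hs : s = Real.pi / ((1 - r) / r) * (toHalfPlane ζ w).re) :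
    h (hypDistBoundary (unitDisk \ closedBall ((1 - (r : ℂ)) * ζ) r) w) = Real.sin s / s := by
  have hwS := (bijOn_toHalfPlane_crescent hζ hr).mapsTo hw
  obtain ⟨v, hv, hvu⟩ := (bijOn_toHalfPlane hζ).surjOn
    (show (⟨(1 - r) / r, (toHalfPlane ζ w).im⟩ : ℂ) ∈ {u : ℂ | 0 < u.re} from hwS.1.trans hwS.2)
  have hre : (toHalfPlane ζ v).re = (1 - r) / r := by rw [hvu]
  have him : (toHalfPlane ζ v).im = (toHalfPlane ζ w).im := by rw [hvu]
  have hwv : (toHalfPlane ζ w).re ≤ (toHalfPlane ζ v).re := hre ▸ hwS.2.le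
  have hd : hypDistBoundary (unitDisk \ closedBall ((1 - (r : ℂ)) * ζ) r) w = hypDist w v := by
    rw [hypDistBoundary, inter_frontier_crescent hr.ne']
    refine IsLeast.csInf_eq ⟨⟨v, ⟨hv, (mem_sphere_iff_re_eq hζ hr (mem_unitDisk.1 hv)).2 hre⟩,
      rfl⟩, ?_⟩
    rintro _ ⟨v', ⟨hv', hvr⟩, rfl⟩
    rw [mem_sphere_iff_re_eq hζ hr (mem_unitDisk.1 hv'), ← hre] at hvr
    refine hypDist_le_hypDist hw.1 hv' ?_
    rw [pseudoHypDist_eq_div_of_im_eq hζ hw.1 hv hwv him, ← hvr]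
    exact div_le_pseudoHypDist hζ hw.1 hv' (hvr ▸ hwv)
  rw [hd]
  exact h_hypDist_eq_of_im_eq hζ hw.1 hv hwv him (by rw [hre, hs])

end Horo

theorem corollary1p3 (G : Set ℂ) (hG : Horo.IsHoroConvex G) (f : ℂ → ℂ)
    (hf : DifferentiableOn ℂ f Horo.unitDisk) (hfG : Set.MapsTo f Horo.unitDisk G) :
    ∀ z ∈ Horo.unitDisk,
      (1 - ‖z‖ ^ 2) * (‖deriv f z‖ / (1 - ‖f z‖ ^ 2)) ≤ Horo.h (Horo.hypDistBoundary G (f z)) ∧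
      ((1 - ‖z‖ ^ 2) * (‖deriv f z‖ / (1 - ‖f z‖ ^ 2)) = Horo.h (Horo.hypDistBoundary G (f z)) ↔
        Horo.IsHoroCrescent G ∧ Horo.IsConformalOnto f G) := by
  open Horo in
  intro z hz
  have hfz : f z ∈ unitDisk := hG.ssubset.1 (hfG hz)
  obtain ⟨ω, hω, hd⟩ := hG.exists_hypDistBoundary_eq hfz
  obtain ⟨_, ⟨ζ, r, hζ, hr, hr1, rfl⟩, hωH, hdisj⟩ := hG.exists_horodisk ω hω
  rw [frontier_ball _ hr.ne'] at hωH
  have hsub : G ⊆ unitDisk \ closedBall ((1 - (r : ℂ)) * ζ) r := by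
    refine fun w hw ↦ ⟨hG.ssubset.1 hw, fun hw' ↦ ?_⟩
    rw [← closure_ball _ hr.ne'] at hw'
    exact ((disjoint_iff_inter_eq_empty.2 hdisj).closure_right hG.isOpen).ne_of_mem hw hw' rfl
  have hmaps := hfG.mono_right hsub
  have hre := (mem_sphere_iff_re_eq hζ hr (mem_unitDisk.1 hω.1)).1 hωH
  have hpick := hyperbolic_deriv_le_of_mapsTo_crescent hζ hr hr1 hf hmaps hz rfl
  have hle := sin_div_le_h_hypDist hζ hfz hω.1
    (by rw [hre]; exact ((bijOn_toHalfPlane_crescent hζ hr).mapsTo (hmaps hz)).2.le) rfl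
  rw [hre] at hle
  -- In the case of equality, `G` lies between the image of `f` and the crescent.
  refine ⟨hd ▸ hpick.1.trans hle, fun heq ↦ ?_, ?_⟩
  · have hbij := hpick.2.1 (hpick.1.antisymm (by rw [heq, hd]; exact hle))
    have hGeq : G = unitDisk \ closedBall ((1 - (r : ℂ)) * ζ) r :=
      hsub.antisymm (hbij.image_eq ▸ hfG.image_subset)
    exact ⟨⟨_, ⟨ζ, r, hζ, hr, hr1, rfl⟩, by rw [closure_ball _ hr.ne', hGeq]⟩, hf, hGeq ▸ hbij⟩
  · rintro ⟨⟨_, ⟨ζ', r', hζ', hr', hr1', rfl⟩, hGeq⟩, -, hbij⟩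
    rw [closure_ball _ hr'.ne'] at hGeq
    subst hGeq
    rw [h_hypDistBoundary_crescent hζ' hr' (hfG hz) rfl]
    exact (hyperbolic_deriv_le_of_mapsTo_crescent hζ' hr' hr1' hf hfG hz rfl).2.2 hbij
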